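/- A \emph{$cp$-semigroup} over $\mathbb N^3$ on $B(H)$ is a family $\Theta=\{\Theta_n\}_{n\in\mathbb N^3}$ of completely positive, contractive, normal maps on $B(H)$ with $\Theta_0=\mathrm{id}$ and $\Theta_{m}\circ\Theta_n=\Theta_{m+n}$. An \emph{$e$-dilation} $(K,u,\mathcal R,\alpha)$ of a family $\{\Phi_n\}_{n\in\mathbb N^3}$ of linear maps on $B(H)$ consists of a Hilbert space $K$, an isometry $u:H\to K$, a von Neumann algebra $\mathcal R\subseteq B(K)$ with $uu^*\in\mathcal R$ and $u^*\mathcal R u=B(H)$, and a semigroup $\alpha=\{\alpha_n\}_{n\in\mathbb N^3}$ (with $\alpha_0=\mathrm{id}$, $\alpha_m\circ\alpha_n=\alpha_{m+n}$) of normal, not necessarily unital, $*$-endomorphisms of $\mathcal R$, such that $$\Phi_n(u^*au)=u^*\alpha_n(a)u\qquad (a\in\mathcal R,\ n\in\mathbb N^3).$$ It is \emph{minimal} if the central support of $uu^*$ in $\mathcal R$ is $1$ and $\mathcal R$ is the von Neumann algebra generated by $\bigcup_n\alpha_n(uB(H)u^*)$. A \emph{subproduct system} of Hilbert spaces over $\mathbb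 N^3$ is a family $\{X(n)\}$ of Hilbert spaces with $X(0)=\mathbb C$ and coisometries $U_{m,n}:X(m)\otimes X(n)\to X(m+n)$ that are associative and are scalar multiplication when $m=0$ or $n=0$; it is a \emph{product system} if all $U_{m,n}$ are unitary. $X$ \emph{embeds} in $Y$ if there are isometries $\iota_n:X(n)\to Y(n)$, with $\iota_0=\mathrm{id}_{\mathbb C}$, such that $p_n=\iota_n^*$ satisfies $p_{m+n}U^Y_{m,n}=U^X_{m,n}(p_m\otimes p_n)$. A \emph{representation} $T$ of $X$ on $H$ is a family of linear maps $T_n:X(n)\to B(H)$ such that $\widetilde T_n:X(n)\otimes H\to H$, $x\otimes h\mapsto T_n(x)h$, is a contraction, $T_0(c)=c\,I$, and $T_{m+n}(U_{m,n}(x\otimes y))=T_m(x)T_n(y)$; it is \emph{injective} if every $T_n$ is. \textbf{Theorem.} There exist a Hilbert space $H$ and a $cp$-semigroup $\Theta=\{\Theta_n\}_{n\in\mathbb N^3}$ on $B(H)$ such that for every $\lambda>0$ the family $\lambda\Theta=\{\lambda^{|n|}\Theta_n\}_{n\in\mathbb N^3}$, $|n|=n_1+n_2+n_3$, has no $e$-dilation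 $(K,u,B(K),\alpha)$ with $\mathcal R=B(K)$, and has no minimal $e$-dilation $(K,u,\mathcal R,\alpha)$ on any von Neumann algebra $\mathcal R$. Moreover, $\Theta$ can be chosen of the form $\Theta_n(a)=\widetilde T_n(I_{X(n)}\otimes a)\widetilde T_n^*$ for an injective representation $T$ on $H$ of a subproduct system $X$ of Hilbert spaces over $\mathbb N^3$ that embeds in no product system of Hilbert spaces. -/

import Mathlib

open scoped TensorProduct CStarAlgebra

universe u v

noncomputable section

namespace CPDilation

/-! ### `cp`-semigroups on `B(H)` and their `e`-dilations -/

section Semigroups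

variable {S : Type*} [AddCommMonoid S]
  {H : Type*} [NormedAddCommGroup H] [InnerProductSpace ℂ H] [CompleteSpace H]

/-- A `cp`-semigroup over the monoid `S` acting on `B(H)`: completely positive, contractive, normal
maps `Θ s` with `Θ 0 = id` and `Θ s ∘ Θ t = Θ (s + t)`. A positive map is normal if it preserves the
least upper bound of every (bounded) increasing net, for the usual order on operators. -/
structure IsCPSemigroup (Θ : S → (H →L[ℂ] H) →ₗ[ℂ] (H →L[ℂ] H)) : Prop where
  completelyPositive : ∀ s, ∃ φ : (H →L[ℂ] H) →CP (H →L[ℂ] H), φ.toLinearMap = Θ s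
  contractive : ∀ s a, ‖Θ s a‖ ≤ ‖a‖
  normal : ∀ s, ScottContinuous (Θ s)
  map_zero : ∀ a, Θ 0 a = a
  map_add : ∀ s t a, Θ (s + t) a = Θ s (Θ t a)

/-- An `e`-dilation `(K, u, 𝓡, α)`, on the Hilbert space `K`, of a family `Θ` of maps on `B(H)`:
`u : H → K` is an isometry, `𝓡 ⊆ B(K)` is a von Neumann algebra that contains the projection `u u⋆`
and satisfies `u⋆ 𝓡 u = B(H)`, and `α` is a semigroup of normal, not necessarily unital,
`*`-endomorphisms of `𝓡` such that `Θ s (u⋆ a u) = u⋆ (α s a) u` for all `a ∈ 𝓡`. -/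
structure EDilation (Θ : S → (H →L[ℂ] H) →ₗ[ℂ] (H →L[ℂ] H))
    (K : Type*) [NormedAddCommGroup K] [InnerProductSpace ℂ K] [CompleteSpace K] where
  u : H →ₗᵢ[ℂ] K
  alg : VonNeumannAlgebra K
  α : S → (alg.toStarSubalgebra →⋆ₙₐ[ℂ] alg.toStarSubalgebra)
  normal : ∀ s, ScottContinuous (α s)
  map_zero : ∀ a, α 0 a = a
  map_add : ∀ s t a, α (s + t) a = α s (α t a)
  proj_mem : u.toContinuousLinearMap ∘L u.toContinuousLinearMap.adjoint ∈ alg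
  compression : ∀ x : H →L[ℂ] H,
    ∃ a ∈ alg, u.toContinuousLinearMap.adjoint ∘L a ∘L u.toContinuousLinearMap = x
  dilates : ∀ s (a : alg.toStarSubalgebra),
    Θ s (u.toContinuousLinearMap.adjoint ∘L (a : K →L[ℂ] K) ∘L u.toContinuousLinearMap) =
      u.toContinuousLinearMap.adjoint ∘L (α s a : K →L[ℂ] K) ∘L u.toContinuousLinearMap

namespace EDilation

variable {Θ : S → (H →L[ℂ] H) →ₗ[ℂ] (H →L[ℂ] H)}
  {K : Type*} [NormedAddCommGroup K] [InnerProductSpace ℂ K] [CompleteSpace K]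

/-- The projection `p = u u⋆` of `K` onto the copy of `H`. -/
def proj (D : EDilation Θ K) : K →L[ℂ] K :=
  D.u.toContinuousLinearMap ∘L D.u.toContinuousLinearMap.adjoint

/-- The dilation acts on all of `B(K)`. -/
def ActsOnAll (D : EDilation Θ K) : Prop := ∀ a : K →L[ℂ] K, a ∈ D.alg

/-- The union of the sets `α s (u B(H) u⋆)`. -/
def orbit (D : EDilation Θ K) : Set (K →L[ℂ] K) :=
  {b | ∃ (s : S) (x : H →L[ℂ] H) (a : D.alg.toStarSubalgebra),
    (a : K →L[ℂ] K) =
      D.u.toContinuousLinearMap ∘L x ∘L D.u.toContinuousLinearMap.adjoint ∧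
    b = (D.α s a : K →L[ℂ] K)}

/-- A minimal `e`-dilation: the central support of `u u⋆` in `𝓡` is `1`, and `𝓡` is the von Neumann
algebra generated by the sets `α s (u B(H) u⋆)` (the double commutant of their union, which is
closed under adjoints). -/
structure IsMinimal (D : EDilation Θ K) : Prop where
  centralSupport : ∀ z ∈ D.alg, z ∈ D.alg.commutant → IsStarProjection z →
    z * D.proj = D.proj → z = 1
  generates : (D.alg : Set (K →L[ℂ] K)) = Set.centralizer (Set.centralizer D.orbit)

end EDilation

end Semigroups

/-! ### Subproduct systems of Hilbert spaces -/

section Tensor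

variable (E F : Type*) [NormedAddCommGroup E] [InnerProductSpace ℂ E]
  [NormedAddCommGroup F] [InnerProductSpace ℂ F]

/-- The Hilbert space tensor product. -/
abbrev HilbertTensor : Type _ := UniformSpace.Completion (E ⊗[ℂ] F)

variable {E F}

/-- The elementary tensor `x ⊗ y`. -/
def htmul (x : E) (y : F) : HilbertTensor E F := ((x ⊗ₜ[ℂ] y : E ⊗[ℂ] F) : HilbertTensor E F)

/-- The bounded operator `f ⊗ g` between Hilbert space tensor products. -/
def hmap {E' F' : Type*} [NormedAddCommGroup E'] [InnerProductSpace ℂ E']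
    [NormedAddCommGroup F'] [InnerProductSpace ℂ F'] (f : E →L[ℂ] E') (g : F →L[ℂ] F') :
    HilbertTensor E F →L[ℂ] HilbertTensor E' F' :=
  (TensorProduct.mapL f g).completion

end Tensor

/-- A subproduct system of Hilbert spaces (that is, of `W⋆`-correspondences over `ℂ`) over the monoid
`S`: Hilbert spaces `X s`, an identification of `X 0` with `ℂ`, and coisometries
`U : X s ⊗ X t → X (s + t)` that are associative and are given by scalar multiplication if `s = 0` or
`t = 0`. The index `r = s + t` is a variable, so that associativity needs no transport. -/
structure SubproductSystem (S : Type*) [AddCommMonoid S] where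
  X : S → Type u
  [normedAddCommGroup : ∀ s, NormedAddCommGroup (X s)]
  [innerProductSpace : ∀ s, InnerProductSpace ℂ (X s)]
  [completeSpace : ∀ s, CompleteSpace (X s)]
  U : ∀ {s t r : S}, s + t = r → (HilbertTensor (X s) (X t) →L[ℂ] X r)
  coisometric : ∀ {s t r : S} (h : s + t = r),
    U h ∘L (U h).adjoint = ContinuousLinearMap.id ℂ (X r)
  scalar : ℂ ≃ₗᵢ[ℂ] X 0
  scalar_left : ∀ {s : S} (c : ℂ) (x : X s), U (zero_add s) (htmul (scalar c) x) = c • x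
  scalar_right : ∀ {s : S} (c : ℂ) (x : X s), U (add_zero s) (htmul x (scalar c)) = c • x
  assoc : ∀ {s t r st tr q : S} (hst : s + t = st) (htr : t + r = tr) (h₁ : st + r = q)
    (h₂ : s + tr = q) (x : X s) (y : X t) (z : X r),
    U h₁ (htmul (U hst (htmul x y)) z) = U h₂ (htmul x (U htr (htmul y z)))

attribute [instance] SubproductSystem.normedAddCommGroup
  SubproductSystem.innerProductSpace SubproductSystem.completeSpace

namespace SubproductSystem

variable {S : Type*} [AddCommMonoid S]

/-- A (full) product system: the coisometries `U` are unitary. -/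
def IsProductSystem (Y : SubproductSystem.{u} S) : Prop :=
  ∀ {s t r : S} (h : s + t = r),
    (Y.U h).adjoint ∘L Y.U h = ContinuousLinearMap.id ℂ (HilbertTensor (Y.X s) (Y.X t))

/-- `X` embeds in `Y`, that is, `X` is (isomorphic to) a subproduct subsystem of `Y`: there are
isometries `ι s : X s → Y s`, compatible with `X 0 = ℂ = Y 0`, whose adjoints `p s` (the orthogonal
projections onto the `X s`) satisfy `p (s + t) ∘ U^Y = U^X ∘ (p s ⊗ p t)`. -/
def EmbedsIn (X : SubproductSystem.{u} S) (Y : SubproductSystem.{v} S) : Prop :=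
  ∃ ι : ∀ s, X.X s →ₗᵢ[ℂ] Y.X s,
    (∀ c : ℂ, ι 0 (X.scalar c) = Y.scalar c) ∧
    ∀ {s t r : S} (h : s + t = r),
      (ι r).toContinuousLinearMap.adjoint ∘L Y.U h =
        X.U h ∘L hmap (ι s).toContinuousLinearMap.adjoint (ι t).toContinuousLinearMap.adjoint

/-- A (completely contractive covariant) representation `T` of the subproduct system `X` on the
Hilbert space `H` with `T 0` unital, given by the contractions `T~ s : X s ⊗ H → H`,
`T~ s (x ⊗ h) = T s (x) h`, and satisfying `T (s + t) (U (x ⊗ y)) = T s (x) T t (y)`. -/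
structure Representation (X : SubproductSystem.{u} S)
    (H : Type*) [NormedAddCommGroup H] [InnerProductSpace ℂ H] where
  tilde : ∀ s, HilbertTensor (X.X s) H →L[ℂ] H
  norm_tilde_le : ∀ s, ‖tilde s‖ ≤ 1
  scalar : ∀ (c : ℂ) (h : H), tilde 0 (htmul (X.scalar c) h) = c • h
  mul : ∀ {s t r : S} (hr : s + t = r) (x : X.X s) (y : X.X t) (h : H),
    tilde r (htmul (X.U hr (htmul x y)) h) = tilde s (htmul x (tilde t (htmul y h)))

namespace Representation

variable {X : SubproductSystem.{u} S}
  {H : Type*} [NormedAddCommGroup H] [InnerProductSpace ℂ H]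

/-- The representation is injective on every fibre. -/
def Injective (T : X.Representation H) : Prop :=
  ∀ s (x : X.X s), (∀ h : H, T.tilde s (htmul x h) = 0) → x = 0

/-- `a ↦ T~ s (I ⊗ a) (T~ s)⋆`. -/
def induced [CompleteSpace H] (T : X.Representation H) (s : S) (a : H →L[ℂ] H) : H →L[ℂ] H :=
  T.tilde s ∘L hmap (ContinuousLinearMap.id ℂ (X.X s)) a ∘L (T.tilde s).adjoint

end Representation

end SubproductSystem

/-- The family `λ^|n| Θ_n`, where `|n| = n₁ + ⋯ + n_k`. -/
def scaled {k : ℕ} {H : Type*} [NormedAddCommGroup H] [InnerProductSpace ℂ H]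
    (lam : ℝ) (Θ : (Fin k → ℕ) → (H →L[ℂ] H) →ₗ[ℂ] (H →L[ℂ] H)) :
    (Fin k → ℕ) → (H →L[ℂ] H) →ₗ[ℂ] (H →L[ℂ] H) :=
  fun n ↦ ((lam : ℂ) ^ (∑ i, n i)) • Θ n

end CPDilation

end

/-!
The example is built from a graded partial monoid `Word` with ten elements, generated by `x₀, x₁,
x₂` in degree `(1,0,0)`, `y` in degree `(0,1,0)` and `z` in degree `(0,0,1)`, with the commutation
relations `x₀ y = y x₀`, `x₁ y = y x₂`, `x₀ z = z x₁`, `y z = z y` and no products of degree three.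
Every word factors uniquely along every decomposition of its degree (`Word.exists_mul`,
`Word.mul_cancel`). Hence the Hilbert spaces with the words of degree `s` as orthonormal bases form
a subproduct system `wordSystem`, with the linearized multiplication as product maps; left
multiplication on the sum of all fibres is an injective representation `wordRep`, and the induced
maps form the `cp`-semigroup `wordSemigroup`. Everything is finite-dimensional, so that normality
follows from positivity (`scottContinuous_of_finiteDimensional`).

The obstruction is that the commutation relations are inconsistent as soon as triple products are
defined and cancellable. With `w = y z = z y`, moving `x₀` to the right through `y` and then through
`z` gives `x₀ w = w x₁`, while moving it through `z` and then through `y` gives `x₀ w = w x₂`.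

* An embedding in a product system preserves every product of words that is defined: the product in
  the larger system has norm `1` and its projection already has norm `1` (`embedding_mul`). A
  product system has no zero divisors, so `w x₁ = w x₂` is impossible (`not_embedsIn_wordSystem`).
* If `α` is a dilation of `λ Θ` on `B(K)`, each word `b` lifts to the operator `L_b : k ↦ α_{deg
  b}(|k⟩⟨u e₁|) u e_b` on `K`. It satisfies `α_{deg b}(a) L_b = L_b a`, it is `λ^{|deg b|/2}` times
  an isometry, and `u⋆ L_b` is `λ^{|deg b|} T_b u⋆` for the Kraus operator `T_b`. Comparing norms
  and inner products gives `L_b L_c = L_{bc}` whenever `b c` is defined (`lift_lift`), and the same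
  computation gives `L_w L_{x₁} = L_w L_{x₂}`, which is impossible (`not_actsOnAll`).
* A minimal dilation acts on all of `B(K)` (`actsOnAll_of_isMinimal`): the commutant of the algebra
  acts on the copy of `H` by scalars, as the compression of the algebra is `B(H)`, and it acts
  faithfully there since the central support of `u u⋆` is `1`.
-/

namespace CPDilation

/-! ### Hilbert space tensor products -/

section Tensor

variable {E F G : Type*} [NormedAddCommGroup E] [InnerProductSpace ℂ E]
  [NormedAddCommGroup F] [InnerProductSpace ℂ F] [NormedAddCommGroup G] [InnerProductSpace ℂ G]

/-- The bounded operator `h ↦ x ⊗ h`. -/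
noncomputable def tensorLeft (x : E) : F →L[ℂ] HilbertTensor E F :=
  UniformSpace.Completion.toComplL ∘L TensorProduct.mkL ℂ E F x

@[simp] lemma tensorLeft_apply (x : E) (h : F) : tensorLeft x h = htmul x h := rfl

@[simp] lemma inner_htmul (x x' : E) (y y' : F) :
    inner ℂ (htmul x y) (htmul x' y') = inner ℂ x x' * inner ℂ y y' := by
  simp [htmul]

@[simp] lemma norm_htmul (x : E) (y : F) : ‖htmul x y‖ = ‖x‖ * ‖y‖ := by
  simp [htmul]

lemma htmul_sub_right (x : E) (y y' : F) : htmul x (y - y') = htmul x y - htmul x y' :=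
  map_sub (tensorLeft x) y y'

@[simp] lemma hmap_htmul {E' F' : Type*} [NormedAddCommGroup E']
    [InnerProductSpace ℂ E'] [NormedAddCommGroup F'] [InnerProductSpace ℂ F']
    (f : E →L[ℂ] E') (g : F →L[ℂ] F') (x : E) (y : F) :
    hmap f g (htmul x y) = htmul (f x) (g y) := by
  simp [hmap, htmul]

lemma norm_hmap_id_le (a : F →L[ℂ] G) : ‖hmap (ContinuousLinearMap.id ℂ E) a‖ ≤ ‖a‖ := by
  refine ContinuousLinearMap.opNorm_le_bound _ (norm_nonneg a) fun x ↦ ?_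
  refine UniformSpace.Completion.induction_on x
    (isClosed_le (by fun_prop) (by fun_prop)) fun x ↦ ?_
  have h : ‖TensorProduct.mapL (ContinuousLinearMap.id ℂ E) a‖ ≤ ‖a‖ :=
    (TensorProduct.norm_mapL_le _ _).trans
      (mul_le_of_le_one_left (norm_nonneg _) ContinuousLinearMap.norm_id_le)
  rw [hmap, ContinuousLinearMap.completion_apply_coe, UniformSpace.Completion.norm_coe,
    UniformSpace.Completion.norm_coe]
  exact (ContinuousLinearMap.le_opNorm _ x).trans (by gcongr)

variable [CompleteSpace F]

lemma adjoint_tensorLeft_htmul (x x' : E) (h : F) :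
    (tensorLeft x : F →L[ℂ] HilbertTensor E F).adjoint (htmul x' h) = inner ℂ x x' • h := by
  refine ext_inner_left ℂ fun k ↦ ?_
  rw [ContinuousLinearMap.adjoint_inner_right, tensorLeft_apply, inner_htmul, inner_smul_right]

variable {ι : Type*} [Fintype ι] [DecidableEq ι]

/-- The row operator `e_i ⊗ h ↦ T_i h` on `ℂ^ι ⊗ F`. -/
noncomputable def row (T : ι → F →L[ℂ] G) : HilbertTensor (EuclideanSpace ℂ ι) F →L[ℂ] G :=
  ∑ i, T i ∘L (tensorLeft (EuclideanSpace.single i (1 : ℂ))).adjoint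

lemma row_htmul (T : ι → F →L[ℂ] G) (x : EuclideanSpace ℂ ι) (h : F) :
    row T (htmul x h) = ∑ i, x i • T i h := by
  simp [row, adjoint_tensorLeft_htmul, EuclideanSpace.inner_single_left]

lemma row_hmap_adjoint_row [CompleteSpace G] (T : ι → F →L[ℂ] G) (a : F →L[ℂ] F) :
    row T ∘L hmap (ContinuousLinearMap.id ℂ _) a ∘L (row T).adjoint =
      ∑ i, T i ∘L a ∘L (T i).adjoint := by
  ext w
  simp only [row, map_sum, ContinuousLinearMap.adjoint_comp, ContinuousLinearMap.adjoint_adjoint]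
  simp [adjoint_tensorLeft_htmul, EuclideanSpace.inner_single_left, apply_ite]

lemma row_adjoint_row [CompleteSpace G] (T : ι → F →L[ℂ] G) :
    row T ∘L (row T).adjoint = ∑ i, T i ∘L (T i).adjoint := by
  have h := row_hmap_adjoint_row T (ContinuousLinearMap.id ℂ F)
  have hid : hmap (ContinuousLinearMap.id ℂ (EuclideanSpace ℂ ι)) (ContinuousLinearMap.id ℂ F) =
      ContinuousLinearMap.id ℂ _ := by
    rw [hmap, TensorProduct.mapL_id_id]
    ext x
    refine UniformSpace.Completion.induction_on x
      (isClosed_eq (by fun_prop) (by fun_prop)) fun x ↦ by simp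
  simpa [hid] using h

end Tensor

/-! ### A graded partial monoid -/

/-- A partial monoid with ten elements. Its generators `x₀, x₁, x₂, y, z` satisfy
`p = x₀ y = y x₀`, `q = x₁ y = y x₂`, `r = x₀ z = z x₁`, `w = y z = z y`; all other products of two
elements different from `one` are undefined. -/
inductive Word
  | one | x₀ | x₁ | x₂ | y | z | p | q | r | w
  deriving DecidableEq

namespace Word

instance : Fintype Word where
  elems := {one, x₀, x₁, x₂, y, z, p, q, r, w}
  complete a := by cases a <;> decide

/-- The partial multiplication; `none` stands for an undefined product. -/
def mul : Word → Word → Option Word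
  | one, a => some a
  | a, one => some a
  | x₀, y => some p
  | y, x₀ => some p
  | x₁, y => some q
  | y, x₂ => some q
  | x₀, z => some r
  | z, x₁ => some r
  | y, z => some w
  | z, y => some w
  | _, _ => none

/-- The degree: the generators `xᵢ`, `y`, `z` have degrees `(1,0,0)`, `(0,1,0)`, `(0,0,1)`. -/
def deg : Word → Fin 3 → ℕ
  | one => ![0, 0, 0]
  | x₀ => ![1, 0, 0]
  | x₁ => ![1, 0, 0]
  | x₂ => ![1, 0, 0]
  | y => ![0, 1, 0]
  | z => ![0, 0, 1]
  | p => ![1, 1, 0]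
  | q => ![1, 1, 0]
  | r => ![1, 0, 1]
  | w => ![0, 1, 1]

@[simp] lemma one_mul (a : Word) : mul one a = some a := by cases a <;> rfl

@[simp] lemma mul_one (a : Word) : mul a one = some a := by cases a <;> rfl

lemma mul_assoc : ∀ a b c : Word, (mul a b).bind (mul · c) = (mul b c).bind (mul a) := by
  decide

lemma deg_mul : ∀ {a b c : Word}, mul a b = some c → deg a + deg b = deg c := by
  decide

lemma deg_one : deg one = 0 := by decide

lemma eq_one_of_deg : ∀ {a : Word}, deg a = 0 → a = one := by decide

/-- A product has at most one factorization with prescribed degrees. -/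
lemma mul_cancel : ∀ {a a' : Word}, deg a = deg a' → ∀ {b b' c : Word},
    mul a b = some c → mul a' b' = some c → a = a' ∧ b = b' := by
  decide

lemma exists_mul_of_le : ∀ (c : Word) (s : Fin 3 → Fin 2), (∀ i, (s i : ℕ) ≤ deg c i) →
    ∃ a b, deg a = (fun i ↦ (s i : ℕ)) ∧ mul a b = some c := by
  decide

lemma deg_le_one : ∀ (c : Word) (i : Fin 3), deg c i ≤ 1 := by decide

/-- Every element factors along every decomposition of its degree. -/
lemma exists_mul {c : Word} {s t : Fin 3 → ℕ} (h : s + t = deg c) :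
    ∃ a b, deg a = s ∧ deg b = t ∧ mul a b = some c := by
  have hs (i) : s i + t i = deg c i := congrFun h i
  obtain ⟨a, b, ha, hab⟩ := exists_mul_of_le c
    (fun i ↦ ⟨s i, by have := hs i; have := deg_le_one c i; omega⟩)
    (fun i ↦ by have := hs i; simp; omega)
  refine ⟨a, b, ha, ?_, hab⟩
  refine add_left_cancel (a := s) ((?_ : s + deg b = deg c).trans h.symm)
  rw [← deg_mul hab, ha]

end Word

/-! ### Left multiplication operators -/

open Word

section MatOp

variable {J K L : Type*} [Fintype J] [Fintype K] [Fintype L] [DecidableEq J] [DecidableEq K]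

/-- The operator between Euclidean spaces given by a matrix. -/
noncomputable def matOp : Matrix L J ℂ →ₗ[ℂ] (EuclideanSpace ℂ J →L[ℂ] EuclideanSpace ℂ L) :=
  LinearMap.toContinuousLinearMap.toLinearMap ∘ₗ Matrix.toEuclideanLin.toLinearMap

lemma matOp_apply (A : Matrix L J ℂ) (x : EuclideanSpace ℂ J) (l : L) :
    matOp A x l = ∑ j, A l j * x j := rfl

lemma matOp_single (A : Matrix L J ℂ) (j : J) (l : L) :
    matOp A (EuclideanSpace.single j 1) l = A l j := by
  simp [matOp_apply]

lemma matOp_comp (A : Matrix L K ℂ) (B : Matrix K J ℂ) :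
    matOp A ∘L matOp B = matOp (A * B) := by
  ext x l
  simp only [ContinuousLinearMap.comp_apply, matOp_apply, Matrix.mul_apply, Finset.sum_mul,
    Finset.mul_sum]
  rw [Finset.sum_comm]
  simp only [_root_.mul_assoc]

lemma adjoint_matOp [DecidableEq L] (A : Matrix L J ℂ) :
    (matOp A).adjoint = matOp A.conjTranspose := by
  refine (ContinuousLinearMap.eq_adjoint_iff _ _).2 (fun x y ↦ ?_) |>.symm
  simp only [PiLp.inner_apply, matOp_apply, RCLike.inner_apply, Matrix.conjTranspose_apply,
    Finset.mul_sum, Finset.sum_mul, map_sum, map_mul, RCLike.star_def, RCLike.conj_conj]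
  rw [Finset.sum_comm]
  refine Finset.sum_congr rfl fun _ _ ↦ Finset.sum_congr rfl fun _ _ ↦ by ring

lemma matOp_one : matOp (1 : Matrix J J ℂ) = ContinuousLinearMap.id ℂ _ := by
  ext x l
  simp [matOp_apply, Matrix.one_apply]

lemma norm_matOp_diagonal_le {d : J → ℂ} (hd : ∀ j, ‖d j‖ ≤ 1) :
    ‖matOp (Matrix.diagonal d)‖ ≤ 1 := by
  refine ContinuousLinearMap.opNorm_le_bound _ zero_le_one fun x ↦ ?_
  rw [_root_.one_mul, EuclideanSpace.norm_eq, EuclideanSpace.norm_eq]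
  gcongr with j
  simpa [matOp_apply, Matrix.diagonal_apply] using
    mul_le_of_le_one_left (norm_nonneg (x j)) (hd j)

end MatOp

/-- The sum has at most one nonzero term, the one with `m = some (f j)`. -/
lemma sum_ite_some {α A J : Type*} [DecidableEq α] [AddCommMonoid A] [Fintype J] {f : J → α}
    (hf : f.Injective) (m : Option α) (hm : ∀ a, m = some a → ∃ j, f j = a) (φ : α → A) :
    ∑ j, (if m = some (f j) then φ (f j) else 0) = m.elim 0 φ := by
  classical
  cases m with
  | none => simp
  | some a =>
    obtain ⟨j, rfl⟩ := hm a rfl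
    simp [hf.eq_iff]

section LeftMul

variable {J K L : Type*} [Fintype J] [Fintype K] [Fintype L] [DecidableEq J] [DecidableEq K]

/-- Left multiplication by `b`, as an operator between the Hilbert spaces that have the families of
words `f` and `g` as orthonormal bases: `e_j` goes to `e_l` if `b (f j) = g l`, and to `0` if the
product is undefined or not in the range of `g`. -/
noncomputable def leftMul (f : J → Word) (g : L → Word) (b : Word) :
    EuclideanSpace ℂ J →L[ℂ] EuclideanSpace ℂ L :=
  matOp (Matrix.of fun l j ↦ if mul b (f j) = some (g l) then 1 else 0)

lemma leftMul_apply (f : J → Word) (g : L → Word) (b : Word) (x : EuclideanSpace ℂ J) (l : L) :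
    leftMul f g b x l = ∑ j, if mul b (f j) = some (g l) then x j else 0 := by
  simp [leftMul, matOp_apply]

lemma leftMul_single [DecidableEq L] (f : J → Word) {g : L → Word} (hg : g.Injective) {b : Word}
    {j : J} {l : L} (h : mul b (f j) = some (g l)) :
    leftMul f g b (EuclideanSpace.single j 1) = EuclideanSpace.single l 1 := by
  ext l'
  rw [leftMul, matOp_single]
  simp [h, hg.eq_iff, eq_comm]

lemma leftMul_one {f : J → Word} (hf : f.Injective) :
    leftMul f f one = ContinuousLinearMap.id ℂ _ := by
  rw [← matOp_one, leftMul]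
  congr 1
  ext l j
  simp [Matrix.one_apply, hf.eq_iff, eq_comm]

lemma leftMul_comp_leftMul (f : J → Word) {m : K → Word} (hm : m.Injective) (g : L → Word)
    (b c : Word) (h : ∀ j e, mul c (f j) = some e → ∃ k, m k = e) :
    leftMul m g b ∘L leftMul f m c = (mul b c).elim 0 (leftMul f g) := by
  have key : ∀ l j, (∑ k, (if mul b (m k) = some (g l) then 1 else 0) *
      (if mul c (f j) = some (m k) then 1 else 0) : ℂ) =
      if (mul b c).bind (mul · (f j)) = some (g l) then 1 else 0 := by
    intro l j
    have := sum_ite_some hm (mul c (f j)) (h j)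
      (fun e ↦ if mul b e = some (g l) then (1 : ℂ) else 0)
    simp only [mul_ite, _root_.mul_one, mul_zero]
    rw [this, mul_assoc]
    cases mul c (f j) <;> simp
  rw [leftMul, leftMul, matOp_comp]
  have : (Matrix.of fun l k ↦ if mul b (m k) = some (g l) then (1 : ℂ) else 0) *
      (Matrix.of fun k j ↦ if mul c (f j) = some (m k) then (1 : ℂ) else 0) =
      Matrix.of fun l j ↦ if (mul b c).bind (mul · (f j)) = some (g l) then 1 else 0 := by
    ext l j
    simpa [Matrix.mul_apply] using key l j
  rw [this]
  cases mul b c with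
  | none =>
    refine Eq.trans (congrArg matOp ?_) (map_zero matOp)
    ext
    simp
  | some d => rfl

/-- The words of degree `s`, which index an orthonormal basis of the fibre over `s`. -/
abbrev Fibre (s : Fin 3 → ℕ) : Type := {a : Word // deg a = s}

/-- The multiplication on the Hilbert space tensor product of the fibre over `s` and the space with
orthonormal basis `f`, with values in the space with orthonormal basis `g`. -/
noncomputable def prodMap (s : Fin 3 → ℕ) (f : J → Word) (g : L → Word) :
    HilbertTensor (EuclideanSpace ℂ (Fibre s)) (EuclideanSpace ℂ J) →L[ℂ] EuclideanSpace ℂ L :=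
  row fun b : Fibre s ↦ leftMul f g b

lemma prodMap_htmul (s : Fin 3 → ℕ) (f : J → Word) (g : L → Word)
    (x : EuclideanSpace ℂ (Fibre s)) (y : EuclideanSpace ℂ J) :
    prodMap s f g (htmul x y) = ∑ b : Fibre s, x b • leftMul f g b y :=
  row_htmul _ _ _

lemma prodMap_single [DecidableEq L] (s : Fin 3 → ℕ) (f : J → Word) {g : L → Word}
    (hg : g.Injective) {b : Fibre s} {j : J} {l : L} (h : mul b (f j) = some (g l)) :
    prodMap s f g (htmul (EuclideanSpace.single b 1) (EuclideanSpace.single j 1)) =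
      EuclideanSpace.single l 1 := by
  rw [prodMap_htmul, Finset.sum_eq_single b] <;> simp +contextual [leftMul_single f hg h]

/-- Associativity of the multiplication maps. -/
lemma prodMap_assoc {s t st : Fin 3 → ℕ} (hst : s + t = st) (f : J → Word) {m : K → Word}
    (hm : m.Injective) (g : L → Word)
    (h : ∀ c j e, deg c = t → mul c (f j) = some e → ∃ k, m k = e)
    (x : EuclideanSpace ℂ (Fibre s)) (y : EuclideanSpace ℂ (Fibre t)) (v : EuclideanSpace ℂ J) :
    prodMap st f g (htmul (prodMap s Subtype.val Subtype.val (htmul x y)) v) =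
      prodMap s m g (htmul x (prodMap t f m (htmul y v))) := by
  have key (b : Fibre s) (c : Fibre t) :
      leftMul m g b (leftMul f m c v) =
        ∑ a : Fibre st, if mul b c = some a.1 then leftMul f g a v else 0 := by
    rw [← ContinuousLinearMap.comp_apply, leftMul_comp_leftMul f hm g b c (h c · · c.2)]
    rw [sum_ite_some Subtype.val_injective (mul b c)
      (fun a ha ↦ ⟨⟨a, by rw [← deg_mul ha, b.2, c.2, hst]⟩, rfl⟩) (fun a ↦ leftMul f g a v)]
    cases mul b.1 c.1 <;> rfl
  simp only [prodMap_htmul, map_sum, map_smul, key, WithLp.ofLp_sum, WithLp.ofLp_smul,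
    Finset.sum_apply, Pi.smul_apply, leftMul_apply, Finset.smul_sum, Finset.sum_smul,
    smul_eq_mul, Finset.mul_sum]
  rw [Finset.sum_comm]
  refine Finset.sum_congr rfl fun b _ ↦ ?_
  rw [Finset.sum_comm]
  refine Finset.sum_congr rfl fun c _ ↦ Finset.sum_congr rfl fun a _ ↦ ?_
  split_ifs <;> simp [mul_smul]

/-- If factorizations are unique, the multiplication map is a partial isometry, whose final space is
spanned by the basis vectors that factor. -/
lemma prodMap_comp_adjoint [DecidableEq L] {s : Fin 3 → ℕ} {f : J → Word} {g : L → Word}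
    (hg : g.Injective) (P : L → Prop) [DecidablePred P]
    (hP : ∀ l, P l ↔ ∃ (b : Fibre s) (j : J), mul b (f j) = some (g l))
    (ht : ∀ (b b' : Fibre s) (j j' : J) c, mul b (f j) = some c → mul b' (f j') = some c →
      b = b' ∧ j = j') :
    prodMap s f g ∘L (prodMap s f g).adjoint =
      matOp (Matrix.diagonal fun l ↦ if P l then 1 else 0) := by
  rw [prodMap, row_adjoint_row]
  simp only [leftMul, adjoint_matOp, matOp_comp, ← map_sum]
  congr 1
  ext l l'
  simp only [Matrix.sum_apply, Matrix.mul_apply, Matrix.of_apply, Matrix.conjTranspose_apply,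
    Matrix.diagonal_apply]
  by_cases hl : P l
  · obtain ⟨b, j, hbj⟩ := (hP l).1 hl
    rw [Finset.sum_eq_single b, Finset.sum_eq_single j]
    · simp [hbj, hl, hg.eq_iff, apply_ite]
    · rintro j' - hj'
      rw [if_neg fun h' ↦ hj' (ht b b j' j _ h' hbj).2, zero_mul]
    · simp
    · rintro b' - hb'
      refine Finset.sum_eq_zero fun j' _ ↦ ?_
      rw [if_neg fun h' ↦ hb' (ht b' b j' j _ h' hbj).1, zero_mul]
    · simp
  · rw [if_neg hl, ite_self]
    refine Finset.sum_eq_zero fun b _ ↦ Finset.sum_eq_zero fun j _ ↦ ?_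
    rw [if_neg fun h' ↦ hl ((hP l).2 ⟨b, j, h'⟩), zero_mul]

end LeftMul

/-! ### The subproduct system and its representation -/

/-- The only word of degree `0` is `one`. -/
abbrev uniqueFibreZero : Unique (Fibre 0) where
  default := ⟨one, deg_one⟩
  uniq a := Subtype.ext (eq_one_of_deg a.2)

/-- The identification of `ℂ` with the fibre over `0`. -/
noncomputable def scalarFibre : ℂ ≃ₗᵢ[ℂ] EuclideanSpace ℂ (Fibre 0) :=
  letI := uniqueFibreZero
  (OrthonormalBasis.singleton (Fibre 0) ℂ).repr

lemma scalarFibre_apply (c : ℂ) (a : Fibre 0) : scalarFibre c a = c :=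
  letI := uniqueFibreZero
  OrthonormalBasis.singleton_repr c a

lemma sum_fibre_zero {A : Type*} [AddCommMonoid A] (φ : Fibre 0 → A) :
    ∑ b, φ b = φ ⟨one, deg_one⟩ :=
  Fintype.sum_eq_single _ fun b hb ↦ (hb (uniqueFibreZero.uniq b)).elim

lemma prodMap_scalarFibre {J : Type*} [Fintype J] [DecidableEq J] {f : J → Word}
    (hf : f.Injective) (c : ℂ) (x : EuclideanSpace ℂ J) :
    prodMap 0 f f (htmul (scalarFibre c) x) = c • x := by
  rw [prodMap_htmul, sum_fibre_zero, scalarFibre_apply]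
  change c • leftMul f f one x = _
  rw [leftMul_one hf, ContinuousLinearMap.id_apply]

lemma prodMap_scalarFibre_right {s : Fin 3 → ℕ} (c : ℂ) (x : EuclideanSpace ℂ (Fibre s)) :
    prodMap s (Subtype.val : Fibre 0 → Word) (Subtype.val : Fibre s → Word)
      (htmul x (scalarFibre c)) = c • x := by
  ext l
  have h (b : Fibre s) : leftMul (Subtype.val : Fibre 0 → Word) (Subtype.val : Fibre s → Word) b
      (scalarFibre c) l = if b = l then c else 0 := by
    rw [leftMul_apply, sum_fibre_zero, scalarFibre_apply]
    change (if mul b one = some l.1 then c else 0) = _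
    simp only [Word.mul_one, Option.some.injEq, Subtype.ext_iff]
  rw [prodMap_htmul]
  simp only [WithLp.ofLp_sum, WithLp.ofLp_smul, Finset.sum_apply, Pi.smul_apply, h]
  simp [mul_comm]

/-- The product map from the fibres over `s` and `t` to the fibre over `r`. -/
noncomputable def fibreMul (s t r : Fin 3 → ℕ) :
    HilbertTensor (EuclideanSpace ℂ (Fibre s)) (EuclideanSpace ℂ (Fibre t)) →L[ℂ]
      EuclideanSpace ℂ (Fibre r) :=
  prodMap s Subtype.val Subtype.val

lemma fibreMul_comp_adjoint {s t r : Fin 3 → ℕ} (h : s + t = r) :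
    fibreMul s t r ∘L (fibreMul s t r).adjoint = ContinuousLinearMap.id ℂ _ := by
  rw [fibreMul, prodMap_comp_adjoint Subtype.val_injective (fun _ ↦ True), ← matOp_one]
  · simp only [if_true, Matrix.diagonal_one]
  · intro l
    obtain ⟨a, b, ha, hb, hab⟩ := exists_mul (h.trans l.2.symm)
    exact ⟨fun _ ↦ ⟨⟨a, ha⟩, ⟨b, hb⟩, hab⟩, fun _ ↦ trivial⟩
  · intro b b' j j' c h₁ h₂
    exact (mul_cancel (b.2.trans b'.2.symm) h₁ h₂).imp Subtype.ext Subtype.ext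

lemma fibreMul_assoc {s t st r tr q : Fin 3 → ℕ} (hst : s + t = st) (htr : t + r = tr)
    (x : EuclideanSpace ℂ (Fibre s)) (y : EuclideanSpace ℂ (Fibre t))
    (v : EuclideanSpace ℂ (Fibre r)) :
    fibreMul st r q (htmul (fibreMul s t st (htmul x y)) v) =
      fibreMul s tr q (htmul x (fibreMul t r tr (htmul y v))) :=
  prodMap_assoc hst _ Subtype.val_injective _
    (fun _ j e hc he ↦ ⟨⟨e, by rw [← deg_mul he, hc, j.2, htr]⟩, rfl⟩) x y v

lemma fibreMul_scalarFibre_left {s : Fin 3 → ℕ} (c : ℂ) (x : EuclideanSpace ℂ (Fibre s)) :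
    fibreMul 0 s s (htmul (scalarFibre c) x) = c • x :=
  prodMap_scalarFibre Subtype.val_injective c x

lemma fibreMul_scalarFibre_right {s : Fin 3 → ℕ} (c : ℂ) (x : EuclideanSpace ℂ (Fibre s)) :
    fibreMul s 0 s (htmul x (scalarFibre c)) = c • x :=
  prodMap_scalarFibre_right c x

/-- The subproduct system of the graded partial monoid: the fibre over `s` has the words of degree
`s` as an orthonormal basis, and the product maps extend the partial multiplication linearly. -/
noncomputable def wordSystem : SubproductSystem.{0} (Fin 3 → ℕ) where
  X s := EuclideanSpace ℂ (Fibre s)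
  normedAddCommGroup := inferInstance
  innerProductSpace := inferInstance
  completeSpace := inferInstance
  U {s t r} _ := fibreMul s t r
  coisometric {s t r} h := by
    change fibreMul s t r ∘L (fibreMul s t r).adjoint = ContinuousLinearMap.id ℂ _
    exact fibreMul_comp_adjoint h
  scalar := scalarFibre
  scalar_left c x := fibreMul_scalarFibre_left c x
  scalar_right c x := fibreMul_scalarFibre_right c x
  assoc hst htr _ _ x y v := fibreMul_assoc hst htr x y v

/-- The Hilbert space with orthonormal basis `Word`. -/
abbrev WordSpace : Type := EuclideanSpace ℂ Word

/-- The basis vector of the word `b`. -/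
noncomputable abbrev ket (b : Word) : WordSpace := EuclideanSpace.single b 1

/-- Left multiplication by the word `b` on the whole space. -/
noncomputable abbrev shift (b : Word) : WordSpace →L[ℂ] WordSpace := leftMul id id b

lemma shift_ket {b c d : Word} (h : mul b c = some d) : shift b (ket c) = ket d :=
  leftMul_single id Function.injective_id h

lemma shift_comp_shift (b c : Word) : shift b ∘L shift c = (mul b c).elim 0 shift :=
  leftMul_comp_leftMul id Function.injective_id id b c fun _ e _ ↦ ⟨e, rfl⟩

/-- Multiplication on the whole space is a partial isometry: words with no factor of degree `s` are
orthogonal to its range. -/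
lemma norm_prodMap_id_le (s : Fin 3 → ℕ) :
    ‖prodMap s (id : Word → Word) (id : Word → Word)‖ ≤ 1 := by
  classical
  have h := prodMap_comp_adjoint (s := s) (f := (id : Word → Word)) Function.injective_id
    (fun l ↦ ∃ (b : Fibre s) (j : Word), mul b (id j) = some l) (fun _ ↦ Iff.rfl)
    fun b b' j j' c h₁ h₂ ↦ (mul_cancel (b.2.trans b'.2.symm) h₁ h₂).imp_left Subtype.ext
  have h1 := ContinuousLinearMap.norm_adjoint_comp_self
    (ContinuousLinearMap.adjoint (prodMap s (id : Word → Word) (id : Word → Word)))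
  rw [ContinuousLinearMap.adjoint_adjoint, h, LinearIsometryEquiv.norm_map] at h1
  have h2 := norm_matOp_diagonal_le
    (d := fun l : Word ↦ if ∃ (b : Fibre s) (j : Word), mul b (id j) = some l then 1 else 0)
    (fun l ↦ by split_ifs <;> simp)
  nlinarith [norm_nonneg (prodMap s (id : Word → Word) (id : Word → Word))]

/-- The regular representation of the subproduct system. -/
noncomputable def wordRep : wordSystem.Representation WordSpace where
  tilde s := prodMap s id id
  norm_tilde_le := norm_prodMap_id_le
  scalar c h := prodMap_scalarFibre Function.injective_id c h
  mul hr x y h := prodMap_assoc hr id Function.injective_id id (fun _ _ e _ _ ↦ ⟨e, rfl⟩) x y h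

lemma eq_zero_of_prodMap_ket_one {s : Fin 3 → ℕ} {x : EuclideanSpace ℂ (Fibre s)}
    (h : prodMap s id id (htmul x (ket one)) = 0) : x = 0 := by
  have hket (b : Word) : leftMul id id b (ket one) = ket b := shift_ket (mul_one b)
  simp only [prodMap_htmul, hket] at h
  ext b
  have h' := congrFun (congrArg WithLp.ofLp h) b.1
  simpa [Pi.single_apply, Subtype.ext_iff.symm] using h'

lemma wordRep_injective : wordRep.Injective :=
  fun _ _ hx ↦ eq_zero_of_prodMap_ket_one (hx (ket one))

/-! ### The `cp`-semigroup -/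

/-- `a ↦ ∑ T_b a T_b⋆`, the sum being over the words `b` of degree `n`. -/
noncomputable def wordSemigroup (n : Fin 3 → ℕ) :
    (WordSpace →L[ℂ] WordSpace) →ₗ[ℂ] (WordSpace →L[ℂ] WordSpace) where
  toFun a := ∑ b : Fibre n, shift b ∘L a ∘L (shift b).adjoint
  map_add' a a' := by simp [ContinuousLinearMap.add_comp, Finset.sum_add_distrib]
  map_smul' c a := by simp [ContinuousLinearMap.smul_comp, Finset.smul_sum]

lemma wordSemigroup_apply (n : Fin 3 → ℕ) (a : WordSpace →L[ℂ] WordSpace) :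
    wordSemigroup n a = ∑ b : Fibre n, shift b ∘L a ∘L (shift b).adjoint := rfl

lemma wordSemigroup_eq_induced (n : Fin 3 → ℕ) (a : WordSpace →L[ℂ] WordSpace) :
    wordSemigroup n a = wordRep.induced n a :=
  (row_hmap_adjoint_row (fun b : Fibre n ↦ shift b) a).symm

lemma norm_wordSemigroup_le (n : Fin 3 → ℕ) (a : WordSpace →L[ℂ] WordSpace) :
    ‖wordSemigroup n a‖ ≤ ‖a‖ := by
  rw [wordSemigroup_eq_induced]
  refine (ContinuousLinearMap.opNorm_comp_le _ _).trans ?_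
  have h := wordRep.norm_tilde_le n
  refine (mul_le_of_le_one_left (norm_nonneg _) h).trans
    ((ContinuousLinearMap.opNorm_comp_le _ _).trans ?_)
  rw [LinearIsometryEquiv.norm_map]
  exact (mul_le_of_le_one_right (norm_nonneg _) h).trans (norm_hmap_id_le a)

lemma wordSemigroup_zero (a : WordSpace →L[ℂ] WordSpace) : wordSemigroup 0 a = a := by
  rw [wordSemigroup_apply, sum_fibre_zero]
  change leftMul id id one ∘L a ∘L (leftMul id id one).adjoint = a
  rw [leftMul_one Function.injective_id]
  ext1 x
  simp [ContinuousLinearMap.adjoint_id]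

lemma elim_mul_eq_sum {A : Type*} [AddCommMonoid A] {s t : Fin 3 → ℕ} (φ : Word → A)
    (b : Fibre s) (c : Fibre t) : (mul b c).elim 0 φ =
      ∑ d : Fibre (s + t), if mul b c = some d.1 then φ d else 0 := by
  rw [sum_ite_some Subtype.val_injective (mul b.1 c.1)
    (fun d hd ↦ ⟨⟨d, by rw [← deg_mul hd, b.2, c.2]⟩, rfl⟩) φ]

/-- Exactly one pair of words of degrees `s` and `t` has a given product of degree `s + t`. -/
lemma sum_sum_ite_mul {A : Type*} [AddCommMonoid A] {s t : Fin 3 → ℕ} (φ : Word → A)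
    (d : Fibre (s + t)) :
    ∑ b : Fibre s, ∑ c : Fibre t, (if mul b c = some d.1 then φ d else 0) = φ d := by
  obtain ⟨b, c, hb, hc, hbc⟩ := exists_mul d.2.symm
  rw [Finset.sum_eq_single ⟨b, hb⟩, Finset.sum_eq_single ⟨c, hc⟩]
  · exact if_pos hbc
  · rintro c' - hc'
    exact if_neg fun h ↦ hc' (Subtype.ext (mul_cancel rfl h hbc).2)
  · simp
  · rintro b' - hb'
    refine Finset.sum_eq_zero fun c' _ ↦ if_neg fun h ↦ hb' ?_
    exact Subtype.ext (mul_cancel (b'.2.trans hb.symm) h hbc).1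
  · simp

/-- Unique factorization, as a change of the index of summation. -/
lemma sum_fibre_mul {A : Type*} [AddCommMonoid A] (s t : Fin 3 → ℕ) (φ : Word → A) :
    ∑ b : Fibre s, ∑ c : Fibre t, (mul b c).elim 0 φ = ∑ d : Fibre (s + t), φ d := by
  simp only [elim_mul_eq_sum]
  conv_lhs => enter [2, b]; rw [Finset.sum_comm]
  rw [Finset.sum_comm]
  exact Finset.sum_congr rfl fun d _ ↦ sum_sum_ite_mul φ d

lemma elim_comp_comp_adjoint_elim {α E F : Type*} [NormedAddCommGroup E] [InnerProductSpace ℂ E]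
    [CompleteSpace E] [NormedAddCommGroup F] [InnerProductSpace ℂ F] [CompleteSpace F]
    (m : Option α) (T : α → E →L[ℂ] F) (a : E →L[ℂ] E) :
    m.elim 0 T ∘L a ∘L (m.elim 0 T).adjoint = m.elim 0 fun d ↦ T d ∘L a ∘L (T d).adjoint := by
  cases m with
  | none => exact ContinuousLinearMap.zero_comp _
  | some d => rfl

lemma comp_conj_comp {E F G : Type*} [NormedAddCommGroup E] [InnerProductSpace ℂ E]
    [CompleteSpace E] [NormedAddCommGroup F] [InnerProductSpace ℂ F] [CompleteSpace F]
    [NormedAddCommGroup G] [InnerProductSpace ℂ G] [CompleteSpace G]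
    (S : F →L[ℂ] G) (T : E →L[ℂ] F) (a : E →L[ℂ] E) :
    S ∘L (T ∘L a ∘L T.adjoint) ∘L S.adjoint = (S ∘L T) ∘L a ∘L (S ∘L T).adjoint := by
  simp only [ContinuousLinearMap.adjoint_comp, ContinuousLinearMap.comp_assoc]

lemma shift_conj_shift (b c : Word) (a : WordSpace →L[ℂ] WordSpace) :
    shift b ∘L (shift c ∘L a ∘L (shift c).adjoint) ∘L (shift b).adjoint =
      (mul b c).elim 0 fun d ↦ shift d ∘L a ∘L (shift d).adjoint := by
  rw [comp_conj_comp, shift_comp_shift, elim_comp_comp_adjoint_elim]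

lemma wordSemigroup_add (s t : Fin 3 → ℕ) (a : WordSpace →L[ℂ] WordSpace) :
    wordSemigroup (s + t) a = wordSemigroup s (wordSemigroup t a) := by
  have h : wordSemigroup s (wordSemigroup t a) = ∑ b : Fibre s, ∑ c : Fibre t,
      shift b ∘L (shift c ∘L a ∘L (shift c).adjoint) ∘L (shift b).adjoint := by
    simp only [wordSemigroup_apply, ContinuousLinearMap.finsetSum_comp,
      ContinuousLinearMap.comp_finsetSum]
  rw [h]
  simp only [shift_conj_shift]
  exact (sum_fibre_mul s t fun d ↦ shift d ∘L a ∘L (shift d).adjoint).symm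

/-! ### Complete positivity and normality -/

section CStar

variable {A : Type*} [CStarAlgebra A] [PartialOrder A] [StarOrderedRing A]

open CStarMatrix in
/-- A map in Kraus form is completely positive. -/
lemma map_sum_conj_nonneg {ι : Type*} [Fintype ι] (T : ι → A) (φ : A →ₗ[ℂ] A)
    (hφ : ∀ a, φ a = ∑ i, T i * a * star (T i)) (k : ℕ) (M : CStarMatrix (Fin k) (Fin k) A)
    (hM : 0 ≤ M) : 0 ≤ M.map φ := by
  rw [StarOrderedRing.nonneg_iff] at hM
  induction hM using AddSubmonoid.closure_induction with
  | mem M hM =>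
    obtain ⟨N, rfl⟩ := hM
    -- the Kraus form of `φ` splits the image of `N⋆ N` into a sum of terms `(N T⋆)⋆ (N T⋆)`
    let S (i : ι) : CStarMatrix (Fin k) (Fin k) A := ofMatrix fun l j ↦ N l j * star (T i)
    have hS (i : ι) (l j : Fin k) : S i l j = N l j * star (T i) := rfl
    have h : (star N * N).map φ = ∑ i, star (S i) * S i := by
      ext j j'
      have hsum (g : ι → CStarMatrix (Fin k) (Fin k) A) : (∑ i, g i) j j' = ∑ i, g i j j' :=
        Matrix.sum_apply j j' Finset.univ g
      rw [hsum]
      simp only [map_apply, hφ, mul_apply, star_apply, hS, star_mul, star_star,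
        Finset.mul_sum, Finset.sum_mul, _root_.mul_assoc]
    change 0 ≤ (star N * N).map φ
    rw [h]
    exact Finset.sum_nonneg fun i _ ↦ star_mul_self_nonneg _
  | zero =>
    have : (0 : CStarMatrix (Fin k) (Fin k) A).map φ = 0 := by
      ext i j
      exact map_zero φ
    exact this.ge
  | add M N _ _ hM hN =>
    have : (M + N).map φ = M.map φ + N.map φ := by
      ext i j
      exact map_add φ _ _
    exact this ▸ add_nonneg hM hN

/-- In finite dimension a positive linear map is normal: the lower part of a bounded increasing net
lies in a compact order interval, and the least upper bound is its only cluster point. -/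
lemma scottContinuous_of_finiteDimensional [FiniteDimensional ℂ A] {φ : A →ₗ[ℂ] A}
    (hφ : Monotone φ) : ScottContinuous φ := by
  intro d hd hdir a ha
  refine ⟨?_, fun b hb ↦ ?_⟩
  · rintro - ⟨x, hx, rfl⟩
    exact hφ (ha.1 hx)
  have : Nonempty d := hd.to_subtype
  have : IsDirectedOrder d := ⟨hdir.directed_val⟩
  have : ProperSpace A := FiniteDimensional.proper ℂ A
  obtain ⟨x₀, hx₀⟩ := hd
  have hK : IsCompact (Set.Icc x₀ a) := by
    refine Metric.isCompact_of_isClosed_isBounded isClosed_Icc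
      (Metric.isBounded_closedBall (x := x₀) (r := ‖a - x₀‖) |>.subset fun x hx ↦ ?_)
    rw [mem_closedBall_iff_norm]
    exact CStarAlgebra.norm_le_norm_of_nonneg_of_le (sub_nonneg.2 hx.1) (sub_le_sub_right hx.2 x₀)
  have htail (x : d) : ∀ᶠ y in Filter.map ((↑) : d → A) Filter.atTop, y ∈ Set.Ici (x : A) :=
    Filter.eventually_map.2 ((Filter.eventually_ge_atTop x).mono fun y hy ↦ hy)
  have hin : ∀ᶠ y in Filter.map ((↑) : d → A) Filter.atTop, y ∈ d :=
    Filter.eventually_map.2 (Filter.Eventually.of_forall Subtype.property)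
  obtain ⟨c, hcK, hc⟩ := hK (f := Filter.map ((↑) : d → A) Filter.atTop)
    (Filter.le_principal_iff.2
      ((htail ⟨x₀, hx₀⟩).and (hin.mono fun y hy ↦ ha.1 hy)))
  have hmem {s : Set A} (hs : IsClosed s)
      (h : ∀ᶠ y in Filter.map ((↑) : d → A) Filter.atTop, y ∈ s) : c ∈ s :=
    isClosed_iff_clusterPt.1 hs c (hc.mono (Filter.le_principal_iff.2 h))
  obtain rfl : c = a :=
    le_antisymm hcK.2 (ha.2 fun x hx ↦ hmem isClosed_Ici (htail ⟨x, hx⟩))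
  have hcont : Continuous φ := φ.continuous_of_finiteDimensional
  exact hmem (s := {z | φ z ≤ b}) (isClosed_le hcont continuous_const)
    (hin.mono fun y hy ↦ hb ⟨y, hy, rfl⟩)

end CStar

lemma wordSemigroup_apply_eq_mul (n : Fin 3 → ℕ) (a : WordSpace →L[ℂ] WordSpace) :
    wordSemigroup n a = ∑ b : Fibre n, shift b * a * star (shift b.1) := rfl

lemma isCPSemigroup_wordSemigroup : IsCPSemigroup wordSemigroup where
  completelyPositive n :=
    ⟨⟨wordSemigroup n, map_sum_conj_nonneg _ _ (wordSemigroup_apply_eq_mul n)⟩, rfl⟩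
  contractive := norm_wordSemigroup_le
  normal n := by
    refine scottContinuous_of_finiteDimensional fun a b hab ↦ sub_nonneg.1 ?_
    rw [← map_sub, wordSemigroup_apply_eq_mul]
    exact Finset.sum_nonneg fun c _ ↦ star_right_conjugate_nonneg (sub_nonneg.2 hab) _
  map_zero := wordSemigroup_zero
  map_add := wordSemigroup_add

/-! ### The subproduct system embeds in no product system -/

/-- The basis vector of the word `b`, in its fibre. -/
noncomputable abbrev fibreSingle (b : Word) : EuclideanSpace ℂ (Fibre (deg b)) :=
  EuclideanSpace.single ⟨b, rfl⟩ 1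

lemma fibreMul_fibreSingle {b c d : Word} (h : mul b c = some d) :
    fibreMul (deg b) (deg c) (deg d) (htmul (fibreSingle b) (fibreSingle c)) = fibreSingle d :=
  prodMap_single (deg b) (Subtype.val : Fibre (deg c) → Word) Subtype.val_injective
    (b := ⟨b, rfl⟩) (j := ⟨c, rfl⟩) (l := (⟨d, rfl⟩ : Fibre (deg d))) h

/-- `fibreSingle`, as an element of the subproduct system. -/
noncomputable def fibreKet (b : Word) : wordSystem.X (deg b) := fibreSingle b

lemma norm_fibreKet (b : Word) : ‖fibreKet b‖ = 1 :=
  (PiLp.norm_single 2 (fun _ ↦ ℂ) (⟨b, rfl⟩ : Fibre (deg b)) (1 : ℂ)).trans norm_one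

lemma wordSystem_U_fibreKet {b c d : Word} (h : mul b c = some d) :
    wordSystem.U (deg_mul h) (htmul (fibreKet b) (fibreKet c)) = fibreKet d :=
  fibreMul_fibreSingle h

lemma fibreKet_ne : fibreKet x₁ ≠ fibreKet x₂ := by
  intro h
  have h' : EuclideanSpace.single (⟨x₁, rfl⟩ : Fibre (deg x₁)) (1 : ℂ) =
    EuclideanSpace.single (⟨x₂, rfl⟩ : Fibre (deg x₁)) 1 := h
  have := congrFun (congrArg WithLp.ofLp h') ⟨x₁, rfl⟩
  simp [Subtype.ext_iff] at this

/-- A vector that is not longer than its projection onto the range of `ι` lies in that range. -/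
lemma eq_apply_adjoint_of_norm_le {E F : Type*} [NormedAddCommGroup E] [InnerProductSpace ℂ E]
    [CompleteSpace E] [NormedAddCommGroup F] [InnerProductSpace ℂ F] [CompleteSpace F]
    (ι : E →ₗᵢ[ℂ] F) {w : F} {x : E} (h : ι.toContinuousLinearMap.adjoint w = x)
    (hw : ‖w‖ ≤ ‖x‖) : w = ι x := by
  have h1 : inner ℂ w (ι x) = inner ℂ x x := by
    conv_rhs => enter [2]; rw [← h]
    rw [ContinuousLinearMap.adjoint_inner_left]
    rfl
  rw [← sub_eq_zero, ← norm_eq_zero, ← sq_eq_zero_iff]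
  refine le_antisymm ?_ (sq_nonneg _)
  rw [@norm_sub_sq ℂ, h1, ι.norm_map, inner_self_eq_norm_sq]
  nlinarith [norm_nonneg w]

/-- An embedding in a product system is multiplicative on those products of vectors whose norm is
the product of the norms. -/
lemma embedding_mul {Y : SubproductSystem.{v} (Fin 3 → ℕ)} (hY : Y.IsProductSystem)
    (ι : ∀ s, wordSystem.X s →ₗᵢ[ℂ] Y.X s)
    (hι : ∀ {s t r : Fin 3 → ℕ} (h : s + t = r),
      (ι r).toContinuousLinearMap.adjoint ∘L Y.U h =
        wordSystem.U h ∘L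
          hmap (ι s).toContinuousLinearMap.adjoint (ι t).toContinuousLinearMap.adjoint)
    {b c d : Word} (h : mul b c = some d) :
    Y.U (deg_mul h) (htmul (ι _ (fibreKet b)) (ι _ (fibreKet c))) = ι _ (fibreKet d) := by
  have hadj {s : Fin 3 → ℕ} (x : wordSystem.X s) :
      (ι s).toContinuousLinearMap.adjoint (ι s x) = x :=
    congrArg (· x) (ι s).adjoint_comp_self
  refine eq_apply_adjoint_of_norm_le _ ?_ ?_
  · have := congrArg (· (htmul (ι _ (fibreKet b)) (ι _ (fibreKet c)))) (hι (deg_mul h))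
    simp only [ContinuousLinearMap.comp_apply, hmap_htmul, hadj] at this
    rw [this, wordSystem_U_fibreKet h]
  · rw [(ContinuousLinearMap.norm_map_iff_adjoint_comp_self _).2 (hY (deg_mul h)), norm_htmul]
    simp [norm_fibreKet]

/-- Multiplying out `x₀ (y z) = x₀ (z y)`, moving `x₀` to the right step by step, gives
`w x₁ = w x₂`. -/
lemma U_w_x₁_eq_U_w_x₂ (Y : SubproductSystem.{v} (Fin 3 → ℕ)) (e : ∀ b, Y.X (deg b))
    (he : ∀ {b c d : Word} (h : mul b c = some d),
      Y.U (deg_mul h) (htmul (e b) (e c)) = e d)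
    {s : Fin 3 → ℕ} (h₁ : deg w + deg x₁ = s) (h₂ : deg w + deg x₂ = s) :
    Y.U h₁ (htmul (e w) (e x₁)) = Y.U h₂ (htmul (e w) (e x₂)) := by
  have key {a b c ab bc : Word} (hab : mul a b = some ab) (hbc : mul b c = some bc)
      (h : deg ab + deg c = s) (h' : deg a + deg bc = s) :
      Y.U h (htmul (e ab) (e c)) = Y.U h' (htmul (e a) (e bc)) := by
    rw [← he hab, ← he hbc, Y.assoc]
  subst h₁
  calc
    _ = Y.U (by decide) (htmul (e y) (e r)) :=
      key (a := y) (b := z) (c := x₁) rfl rfl _ (by decide)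
    _ = Y.U (by decide) (htmul (e p) (e z)) :=
      (key (a := y) (b := x₀) (c := z) rfl rfl (by decide) _).symm
    _ = Y.U (by decide) (htmul (e x₀) (e w)) :=
      key (a := x₀) (b := y) (c := z) rfl rfl _ (by decide)
    _ = Y.U (by decide) (htmul (e r) (e y)) :=
      (key (a := x₀) (b := z) (c := y) rfl rfl (by decide) _).symm
    _ = Y.U (by decide) (htmul (e z) (e q)) :=
      key (a := z) (b := x₁) (c := y) rfl rfl _ (by decide)
    _ = _ := (key (a := z) (b := y) (c := x₂) rfl rfl _ _).symm

lemma htmul_right_injective {E F : Type*} [NormedAddCommGroup E] [InnerProductSpace ℂ E]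
    [NormedAddCommGroup F] [InnerProductSpace ℂ F] {x : E} (hx : x ≠ 0) :
    Function.Injective (htmul x : F → HilbertTensor E F) := by
  intro y y' h
  have h' : ‖htmul x (y - y')‖ = 0 := by rw [htmul_sub_right, h, sub_self, norm_zero]
  rw [norm_htmul, mul_eq_zero, norm_eq_zero, norm_eq_zero, sub_eq_zero] at h'
  exact h'.resolve_left hx

/-- A product system has no zero divisors, so `w x₁ = w x₂` is impossible in one. -/
lemma not_embedsIn_wordSystem (Y : SubproductSystem.{v} (Fin 3 → ℕ)) (hY : Y.IsProductSystem) :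
    ¬ wordSystem.EmbedsIn Y := by
  rintro ⟨ι, -, hι⟩
  have h := U_w_x₁_eq_U_w_x₂ Y (fun b ↦ ι _ (fibreKet b)) (embedding_mul hY ι hι) rfl rfl
  have hinj : Function.Injective (Y.U (rfl : deg w + deg x₁ = _)) :=
    (AddMonoidHomClass.isometry_of_norm _
      ((ContinuousLinearMap.norm_map_iff_adjoint_comp_self _).2 (hY rfl))).injective
  have hw : ι _ (fibreKet w) ≠ 0 := by
    rw [← norm_ne_zero_iff, (ι _).norm_map, norm_fibreKet]
    exact one_ne_zero
  exact fibreKet_ne ((ι _).injective (htmul_right_injective hw (hinj h)))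

/-! ### Minimal dilations act on all bounded operators -/

open InnerProductSpace

/-- The centre of `B(H)` consists of the scalars. -/
lemma exists_smul_of_commute {H : Type*} [NormedAddCommGroup H] [InnerProductSpace ℂ H]
    {T : H →L[ℂ] H} (hT : ∀ x : H →L[ℂ] H, T ∘L x = x ∘L T) : ∃ c : ℂ, ∀ h, T h = c • h := by
  by_cases hH : ∃ w : H, w ≠ 0
  · obtain ⟨w, hw⟩ := hH
    have hw' : (inner ℂ w w : ℂ) ≠ 0 := inner_self_ne_zero.2 hw
    refine ⟨(inner ℂ w w)⁻¹ * inner ℂ w (T w), fun h ↦ ?_⟩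
    have := congrArg (· w) (hT (rankOne ℂ h w))
    simp only [ContinuousLinearMap.comp_apply, rankOne_apply, map_smul] at this
    rw [mul_smul, ← this, inv_smul_smul₀ hw']
  · push Not at hH
    exact ⟨0, fun h ↦ by simp [hH h]⟩

section Minimal

variable {S H K : Type*} [AddCommMonoid S] [NormedAddCommGroup H] [InnerProductSpace ℂ H]
  [CompleteSpace H] [NormedAddCommGroup K] [InnerProductSpace ℂ K] [CompleteSpace K]
  {Θ : S → (H →L[ℂ] H) →ₗ[ℂ] (H →L[ℂ] H)} (D : EDilation Θ K)

lemma adjoint_apply_u (h : H) : D.u.toContinuousLinearMap.adjoint (D.u h) = h :=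
  congrArg (· h) D.u.adjoint_comp_self

/-- The operators in the commutant leave the copy of `H` invariant. -/
lemma commutant_apply_u {c : K →L[ℂ] K} (hc : c ∈ D.alg.commutant) (h : H) :
    c (D.u h) = D.u (D.u.toContinuousLinearMap.adjoint (c (D.u h))) := by
  have h1 := congrArg (· (D.u h)) (VonNeumannAlgebra.mem_commutant_iff.1 hc _ D.proj_mem)
  have h2 : D.u (D.u.toContinuousLinearMap.adjoint (c (D.u h))) =
      c (D.u (D.u.toContinuousLinearMap.adjoint (D.u h))) := h1
  rw [h2, adjoint_apply_u]

/-- The operators in the commutant act on the copy of `H` as scalars, since the compression of the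
algebra to it is `B(H)`. -/
lemma exists_commutant_apply_u_eq_smul {c : K →L[ℂ] K} (hc : c ∈ D.alg.commutant) :
    ∃ t : ℂ, ∀ h, c (D.u h) = t • D.u h := by
  obtain ⟨t, ht⟩ := exists_smul_of_commute
    (T := D.u.toContinuousLinearMap.adjoint ∘L c ∘L D.u.toContinuousLinearMap) fun x ↦ by
      obtain ⟨a, ha, rfl⟩ := D.compression x
      have hca (k : K) : a (c k) = c (a k) :=
        congrArg (· k) (VonNeumannAlgebra.mem_commutant_iff.1 hc a ha)
      have hadj (k : K) :
          D.u.toContinuousLinearMap.adjoint (c (D.u (D.u.toContinuousLinearMap.adjoint k))) =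
            D.u.toContinuousLinearMap.adjoint (c k) := by
        have h1 : D.u (D.u.toContinuousLinearMap.adjoint (c k)) =
            c (D.u (D.u.toContinuousLinearMap.adjoint k)) :=
          congrArg (· k) (VonNeumannAlgebra.mem_commutant_iff.1 hc _ D.proj_mem)
        rw [← h1, adjoint_apply_u]
      ext1 h
      change D.u.toContinuousLinearMap.adjoint
          (c (D.u (D.u.toContinuousLinearMap.adjoint (a (D.u h))))) =
        D.u.toContinuousLinearMap.adjoint
          (a (D.u (D.u.toContinuousLinearMap.adjoint (c (D.u h)))))
      rw [hadj, ← commutant_apply_u D hc, hca]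
  refine ⟨t, fun h ↦ ?_⟩
  rw [commutant_apply_u D hc, ← map_smul]
  exact congrArg D.u (ht h)

/-- The common kernel of the operators in the commutant that vanish on the copy of `H`. -/
def commutantKernel : Submodule ℂ K where
  carrier := {k | ∀ d ∈ D.alg.commutant, (∀ h, d (D.u h) = 0) → d k = 0}
  add_mem' hk hk' d hd hdu := by rw [map_add, hk d hd hdu, hk' d hd hdu, add_zero]
  zero_mem' d _ _ := map_zero d
  smul_mem' c k hk d hd hdu := by rw [map_smul, hk d hd hdu, smul_zero]

lemma mem_commutantKernel {k : K} : k ∈ commutantKernel D ↔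
    ∀ d ∈ D.alg.commutant, (∀ h, d (D.u h) = 0) → d k = 0 := Iff.rfl

lemma isClosed_commutantKernel : IsClosed (commutantKernel D : Set K) := by
  have : (commutantKernel D : Set K) =
      ⋂ (d : K →L[ℂ] K) (_ : d ∈ D.alg.commutant) (_ : ∀ h, d (D.u h) = 0), {k | d k = 0} := by
    ext k
    simp [mem_commutantKernel]
  rw [this]
  exact isClosed_iInter fun d ↦ isClosed_iInter fun _ ↦ isClosed_iInter fun _ ↦
    isClosed_eq d.continuous continuous_const

/-- If the central support of `u u⋆` is `1`, then the algebra is `B(K)`: an operator of the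
commutant that vanishes on the copy of `H` is `0`, because the projection onto the common kernel of these
operators is central and dominates `u u⋆`; hence the commutant consists of scalars. -/
lemma actsOnAll_of_isMinimal (hD : D.IsMinimal) : D.ActsOnAll := by
  have : CompleteSpace (commutantKernel D) :=
    (isClosed_commutantKernel D).completeSpace_coe
  let z : K →L[ℂ] K := (commutantKernel D).starProjection
  have hz : IsStarProjection z := isStarProjection_starProjection
  have hrange : z.range = commutantKernel D := Submodule.range_starProjection _
  have hz_mem : z ∈ D.alg := by
    rw [VonNeumannAlgebra.IsStarProjection.mem_iff hz]
    intro c hc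
    rw [hrange]
    intro k hk d hd hdu
    refine hk (d * c) (mul_mem hd hc) fun h ↦ ?_
    change d (c (D.u h)) = 0
    rw [commutant_apply_u D hc, hdu]
  have hz_comm : z ∈ D.alg.commutant := by
    rw [VonNeumannAlgebra.IsStarProjection.mem_iff hz, VonNeumannAlgebra.commutant_commutant]
    intro a ha
    rw [hrange]
    intro k hk d hd hdu
    have h1 : a (d k) = d (a k) :=
      congrArg (· k) (VonNeumannAlgebra.mem_commutant_iff.1 hd a ha)
    exact h1.symm.trans (by rw [hk d hd hdu, map_zero])
  have hz_one : z = 1 := by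
    refine hD.centralSupport z hz_mem hz_comm hz ?_
    ext1 k
    exact Submodule.starProjection_eq_self_iff.2 fun d _ hdu ↦ hdu _
  intro a
  rw [← D.alg.commutant_commutant, VonNeumannAlgebra.mem_commutant_iff]
  intro c hc
  obtain ⟨t, ht⟩ := exists_commutant_apply_u_eq_smul D hc
  have hct (k : K) : c k = t • k := by
    have hk : k ∈ commutantKernel D := by
      rw [← Submodule.starProjection_eq_self_iff]
      exact congrArg (· k) hz_one
    have := hk (c - t • 1) (sub_mem hc ?_) fun h ↦ by simp [ht]
    · simpa [sub_eq_zero] using this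
    · exact D.alg.commutant.toStarSubalgebra.smul_mem (one_mem _) t
  ext k
  simp [hct]

end Minimal

/-! ### Dilations acting on all bounded operators -/

/-- The Kraus operator `T_b` is recovered from the `cp`-semigroup by evaluating it at the rank one
operators `|v⟩⟨e₁|`. -/
lemma wordSemigroup_rankOne (b : Word) (v : WordSpace) :
    wordSemigroup (deg b) (rankOne ℂ v (ket one)) (ket b) = shift b v := by
  have h (c : Fibre (deg b)) : (shift c ∘L rankOne ℂ v (ket one) ∘L (shift c).adjoint) (ket b) =
      if c = ⟨b, rfl⟩ then shift b v else 0 := by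
    rw [ContinuousLinearMap.comp_apply, ContinuousLinearMap.comp_apply, rankOne_apply,
      ContinuousLinearMap.adjoint_inner_right, shift_ket (mul_one c.1)]
    by_cases hc : c = ⟨b, rfl⟩
    · subst hc
      simp
    · rw [if_neg hc, EuclideanSpace.inner_single_left, PiLp.single_apply,
        if_neg fun h ↦ hc (Subtype.ext h)]
      simp
  rw [wordSemigroup_apply, sum_apply, Finset.sum_congr rfl fun c _ ↦ h c]
  simp

section Dilation

variable {K : Type*} [NormedAddCommGroup K] [InnerProductSpace ℂ K] [CompleteSpace K]

/-- The semigroup of a dilation that acts on all of `B(K)`, as a family of endomorphisms of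
`B(K)`. -/
noncomputable def dilationAct {S H : Type*} [AddCommMonoid S] [NormedAddCommGroup H]
    [InnerProductSpace ℂ H] [CompleteSpace H] {Θ : S → (H →L[ℂ] H) →ₗ[ℂ] (H →L[ℂ] H)}
    (D : EDilation Θ K) (hD : D.ActsOnAll) (s : S) : (K →L[ℂ] K) →⋆ₙₐ[ℂ] (K →L[ℂ] K) where
  toFun a := (D.α s ⟨a, hD a⟩ : K →L[ℂ] K)
  map_smul' c a := congrArg Subtype.val ((D.α s).map_smul' c ⟨a, hD a⟩)
  map_zero' := congrArg Subtype.val ((D.α s).map_zero')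
  map_add' a b := congrArg Subtype.val ((D.α s).map_add' ⟨a, hD a⟩ ⟨b, hD b⟩)
  map_mul' a b := congrArg Subtype.val ((D.α s).map_mul' ⟨a, hD a⟩ ⟨b, hD b⟩)
  map_star' a := congrArg Subtype.val ((D.α s).map_star' ⟨a, hD a⟩)

variable {lam : ℝ} (D : EDilation (scaled lam wordSemigroup) K) (hD : D.ActsOnAll)

lemma dilationAct_add (s t : Fin 3 → ℕ) (a : K →L[ℂ] K) :
    dilationAct D hD (s + t) a = dilationAct D hD s (dilationAct D hD t a) :=
  congrArg Subtype.val (D.map_add s t ⟨a, hD a⟩)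

/-- The operator `k ↦ α (|k⟩⟨u e₁|) u e_b` on `K`. It intertwines the identity with the endomorphism
`α` of degree `deg b`, and it lifts a multiple of the Kraus operator `T_b`. -/
noncomputable def lift (b : Word) (k : K) : K :=
  dilationAct D hD (deg b) (rankOne ℂ k (D.u (ket one))) (D.u (ket b))

lemma lift_sub (b : Word) (k k' : K) :
    lift D hD b (k - k') = lift D hD b k - lift D hD b k' := by
  simp [lift, map_sub]

lemma lift_smul (b : Word) (c : ℂ) (k : K) : lift D hD b (c • k) = c • lift D hD b k := by
  simp [lift, map_smul]

lemma dilationAct_lift (b : Word) (a : K →L[ℂ] K) (k : K) :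
    dilationAct D hD (deg b) a (lift D hD b k) = lift D hD b (a k) := by
  have h : a * rankOne ℂ k (D.u (ket one)) = rankOne ℂ (a k) (D.u (ket one)) := by
    ext; simp
  rw [lift, lift, ← h, map_mul]
  rfl

/-- The copy of `H` is coinvariant for the lifts, which compress to multiples of the Kraus
operators. -/
lemma adjoint_lift (b : Word) (k : K) :
    D.u.toContinuousLinearMap.adjoint (lift D hD b k) = (lam : ℂ) ^ (∑ i, deg b i) •
      shift b (D.u.toContinuousLinearMap.adjoint k) := by
  have h := D.dilates (deg b) ⟨rankOne ℂ k (D.u (ket one)), hD _⟩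
  have h' : D.u.toContinuousLinearMap.adjoint ∘L rankOne ℂ k (D.u (ket one)) ∘L
      D.u.toContinuousLinearMap =
      rankOne ℂ (D.u.toContinuousLinearMap.adjoint k) (ket one) := by
    ext1 v
    simp
  rw [h'] at h
  rw [← wordSemigroup_rankOne]
  exact congrArg (· (ket b)) h.symm

lemma inner_u_lift (b : Word) (k : K) (v : WordSpace) :
    inner ℂ (D.u v) (lift D hD b k) = (lam : ℂ) ^ (∑ i, deg b i) *
      inner ℂ v (shift b (D.u.toContinuousLinearMap.adjoint k)) := by
  rw [← inner_smul_right, ← adjoint_lift, ContinuousLinearMap.adjoint_inner_right]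
  rfl

lemma inner_u_lift_ket_one (b c : Word) :
    inner ℂ (D.u (ket c)) (lift D hD b (D.u (ket one))) =
      (lam : ℂ) ^ (∑ i, deg b i) * inner ℂ (ket c) (ket b) := by
  rw [inner_u_lift, adjoint_apply_u, shift_ket (mul_one b)]

lemma inner_lift_left (b : Word) (k g : K) :
    inner ℂ (lift D hD b k) g =
      inner ℂ (D.u (ket b)) (dilationAct D hD (deg b) (rankOne ℂ (D.u (ket one)) k) g) := by
  rw [← adjoint_rankOne, ← ContinuousLinearMap.star_eq_adjoint, map_star,
    ContinuousLinearMap.star_eq_adjoint, ContinuousLinearMap.adjoint_inner_right, lift]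

/-- The lift of `b` is `λ^(|deg b| / 2)` times an isometry. -/
lemma inner_lift_lift_self (b : Word) (k : K) :
    inner ℂ (lift D hD b k) (lift D hD b k) = (lam : ℂ) ^ (∑ i, deg b i) * inner ℂ k k := by
  rw [inner_lift_left, dilationAct_lift, rankOne_apply, lift_smul, inner_smul_right,
    inner_u_lift_ket_one, mul_comm]
  simp

/-- The lifts multiply like the words. Both sides have the same norm, and their inner product is
computed in `H`, where the Kraus operators multiply like the words. -/
lemma lift_lift {b c d : Word} (h : mul b c = some d) (k : K) :
    lift D hD b (lift D hD c k) = lift D hD d k := by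
  have hsum : ∑ i, deg d i = ∑ i, deg b i + ∑ i, deg c i := by
    rw [← deg_mul h]
    exact Finset.sum_add_distrib
  have hact (a : K →L[ℂ] K) : dilationAct D hD (deg d) a =
      dilationAct D hD (deg b) (dilationAct D hD (deg c) a) := by
    rw [← deg_mul h, dilationAct_add]
  have h1 : inner ℂ (lift D hD d k) (lift D hD b (lift D hD c k)) =
      (lam : ℂ) ^ (∑ i, deg d i) * inner ℂ k k := by
    rw [inner_lift_left, hact, dilationAct_lift, dilationAct_lift,
      rankOne_apply, lift_smul, lift_smul, inner_smul_right, inner_u_lift, adjoint_lift,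
      adjoint_apply_u, shift_ket (mul_one c), map_smul, shift_ket h, inner_smul_right,
      ← _root_.mul_assoc (_ ^ _), ← pow_add, ← hsum, mul_comm]
    simp
  rw [← sub_eq_zero, ← inner_self_eq_zero (𝕜 := ℂ), inner_sub_left, inner_sub_right,
    inner_sub_right, h1, inner_lift_lift_self, inner_lift_lift_self, inner_lift_lift_self,
    ← inner_conj_symm (lift D hD b _), h1, hsum]
  simp only [map_mul, map_pow, Complex.conj_ofReal, inner_conj_symm]
  ring

/-- As in a product system, multiplying out `x₀ y z = x₀ z y` gives `w x₁ = w x₂` for the lifts. -/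
lemma lift_w_lift_x₁ (k : K) : lift D hD w (lift D hD x₁ k) = lift D hD w (lift D hD x₂ k) := by
  have key {a b c ab bc : Word} (hab : mul a b = some ab) (hbc : mul b c = some bc) :
      lift D hD ab (lift D hD c k) = lift D hD a (lift D hD bc k) := by
    rw [← lift_lift D hD hab, lift_lift D hD hbc]
  calc
    _ = lift D hD y (lift D hD r k) := key (a := y) (b := z) (c := x₁) rfl rfl
    _ = lift D hD p (lift D hD z k) := (key (a := y) (b := x₀) (c := z) rfl rfl).symm
    _ = lift D hD x₀ (lift D hD w k) := key (a := x₀) (b := y) (c := z) rfl rfl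
    _ = lift D hD r (lift D hD y k) := (key (a := x₀) (b := z) (c := y) rfl rfl).symm
    _ = lift D hD z (lift D hD q k) := key (a := z) (b := x₁) (c := y) rfl rfl
    _ = _ := (key (a := z) (b := y) (c := x₂) rfl rfl).symm

lemma not_actsOnAll (hlam : 0 < lam) (D : EDilation (scaled lam wordSemigroup) K) :
    ¬ D.ActsOnAll := by
  intro hD
  have hne (n : ℕ) : (lam : ℂ) ^ n ≠ 0 := pow_ne_zero n (Complex.ofReal_ne_zero.2 hlam.ne')
  have h := lift_w_lift_x₁ D hD (D.u (ket one))
  rw [← sub_eq_zero, ← lift_sub, ← inner_self_eq_zero (𝕜 := ℂ), inner_lift_lift_self, mul_eq_zero,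
    or_iff_right (hne _), inner_self_eq_zero, sub_eq_zero] at h
  have h' := congrArg (inner ℂ (D.u (ket x₁))) h
  rw [inner_u_lift_ket_one, inner_u_lift_ket_one] at h'
  simp [hne, deg, EuclideanSpace.inner_single_left] at h'

end Dilation

end CPDilation

open CPDilation in
theorem mainTheorem4 :
    ∃ (H : Type) (_ : NormedAddCommGroup H) (_ : InnerProductSpace ℂ H) (_ : CompleteSpace H)
      (Θ : (Fin 3 → ℕ) → (H →L[ℂ] H) →ₗ[ℂ] (H →L[ℂ] H)),
      IsCPSemigroup Θ ∧
      (∃ (X : SubproductSystem.{0} (Fin 3 → ℕ)) (T : X.Representation H),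
        (∀ Y : SubproductSystem.{v} (Fin 3 → ℕ), Y.IsProductSystem → ¬ X.EmbedsIn Y) ∧
        T.Injective ∧ ∀ n a, Θ n a = T.induced n a) ∧
      ∀ lam : ℝ, 0 < lam →
        ∀ (K : Type u) [NormedAddCommGroup K] [InnerProductSpace ℂ K] [CompleteSpace K]
          (D : EDilation (scaled lam Θ) K), ¬ D.ActsOnAll ∧ ¬ D.IsMinimal := by
  refine ⟨WordSpace, inferInstance, inferInstance, inferInstance, wordSemigroup,
    isCPSemigroup_wordSemigroup,
    ⟨wordSystem, wordRep, not_embedsIn_wordSystem, wordRep_injective, wordSemigroup_eq_induced⟩, ?_⟩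
  intro lam hlam K _ _ _ D
  exact ⟨not_actsOnAll hlam D, fun hD ↦ not_actsOnAll hlam D (actsOnAll_of_isMinimal D hD)⟩
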